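/- **Definitions.** A *good semigroup* of $\mathbb{N}^r$ ($r\ge 1$) is a submonoid $S\subseteq(\mathbb{N}^r,+)$ such that: (i) $\min(a,b)\in S$ (componentwise minimum) for all $a,b\in S$; (ii) if $a,b\in S$ and $a[i]=b[i]$, there is $c\in S$ with $c[i]>a[i]$, $c[j]\ge\min(a[j],b[j])$ for all $j\ne i$, and $c[j]=\min(a[j],b[j])$ whenever $a[j]\neq b[j]$; (iii) $\delta+\mathbb{N}^r\subseteq S$ for some $\delta\in S$. It is *local* if $\mathbf 0$ is its only element with a zero component, and *Arf* if $\{\beta-\alpha:\beta\in S,\ \beta\ge\alpha\}$ is closed under addition for every $\alpha\in S$. The *conductor* of $S$ is the least $\delta$ with $\delta+\mathbb{N}^r\subseteq S$. The *genus* of $S$ is the length of a saturated chain from $\mathbf 0$ to $\delta$ in $\mathbb{N}^r$ minus the length of a saturated chain from $\mathbf 0$ to $\delta$ in $S$. Let $T$ be a rooted tree with $r$ infinite branches whose nodes are vectors of $\mathbb{N}^r$; let $\mathbf n_i^j$ be the node of the $i$-th branch on level $j\ge1$. All branches share the root $\mathbf n_i^1$, and $\mathbf n_i^j[h]=0$ if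 and only if $\mathbf n_i^j$ does not lie on the $h$-th branch. Two branches are *glued* on level $j$ if they have the same node there. $T$ is the *multiplicity tree* of a local Arf good semigroup $S$ if $S$ consists of $\mathbf 0$ and of all sums $\sum_{\mathbf n\in T'}\mathbf n$ over the finite subtrees $T'$ of $T$ containing the root. $T$ is *untwisted* if two branches $i<h$ are glued on a level exactly when all pairs of consecutive branches between them are glued there. An untwisted multiplicity tree is written $T_E=(p_1,\dots,p_{r-1})$, $E=\{M_1,\dots,M_r\}$ (an ordered collection), where $M_i[j]=\mathbf n_i^j[i]$ and $p_i\ge 1$ is the highest level on which the branches $i$ and $i+1$ are glued; thus $\mathbf n_i^j[h]=M_h[j]$ if $j\le p_l$ for all $\min(i,h)\le l<\max(i,h)$, and $\mathbf n_i^j[h]=0$ otherwise. For a sequence $M$ occurring in such an $E$, let $s_{M,k}$ be the integer with $M[k]=\sum_{l=k+1}^{s_{M,k}}M[l]$. Put $\mathrm{Comp}(M,M)=+\infty$ and, for $M\ne M'$, $\mathrm{Comp}(M,M')=\min\{\min(s_{M,k},s_{M',k}):s_{M,k}\ne s_{M',k}\}$. Let $\mathrm{Gen}(r,n)$ be the set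 of the untwisted multiplicity trees of the local Arf good semigroups of $\mathbb{N}^r$ with genus $n$. **Statement.** Let $r\ge2$ and $1\le t<r$. If $n\ge r-1$, then $$\mathrm{Gen}(r,n)=\bigcup_{p=1}^{n-r+2}\ \bigcup_{k=t-1}^{n-p-r+t+1} I_r^n(t,p,k),$$ where $I_r^n(t,p,k)$ is the set of all $T_E=(p_1,\dots,p_{r-1})$, $E=\{M_1,\dots,M_r\}$, such that - $T_{E_t}=(p_1,\dots,p_{t-1})\in\mathrm{Gen}(t,k)$, where $E_t=\{M_1,\dots,M_t\}$; - $T_{E^t}=(p_{t+1},\dots,p_{r-1})\in\mathrm{Gen}(r-t,\,n-p-k)$, where $E^t=\{M_{t+1},\dots,M_r\}$; - $p_t=p\le\mathrm{Comp}(M_t,M_{t+1})$. If $0\le n<r-1$, then $\mathrm{Gen}(r,n)=\emptyset$. -/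

import Mathlib

namespace ArfGenus

/-! ### Good semigroups of `ℕ^r`, conductor and genus -/

/-- A good semigroup of `ℕ^r`. -/
structure IsGoodSemigroup {r : ℕ} (S : AddSubmonoid (Fin r → ℕ)) : Prop where
  min_mem : ∀ a ∈ S, ∀ b ∈ S, a ⊓ b ∈ S
  exchange : ∀ a ∈ S, ∀ b ∈ S, ∀ i, a i = b i →
    ∃ c ∈ S, a i < c i ∧ (∀ j, j ≠ i → min (a j) (b j) ≤ c j) ∧
      ∀ j, a j ≠ b j → c j = min (a j) (b j)
  exists_conductor : ∃ δ ∈ S, ∀ v, δ + v ∈ S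

/-- `S` is local: the zero vector is the only element with some zero component. -/
def IsLocal {r : ℕ} (S : AddSubmonoid (Fin r → ℕ)) : Prop :=
  ∀ a ∈ S, (∃ i, a i = 0) → a = 0

/-- The Arf property: for each `α ∈ S` the set `S(α) - α = {x : α + x ∈ S}` is closed under
addition. -/
def IsArf {r : ℕ} (S : AddSubmonoid (Fin r → ℕ)) : Prop :=
  ∀ α ∈ S, ∀ x y, α + x ∈ S → α + y ∈ S → α + (x + y) ∈ S

/-- `S` is a local Arf good semigroup of `ℕ^r`. -/
structure IsLocalArfGood {r : ℕ} (S : AddSubmonoid (Fin r → ℕ)) : Prop where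
  good : IsGoodSemigroup S
  isLocal : IsLocal S
  arf : IsArf S

/-- `δ` is the conductor of `S`: the least vector with `δ + ℕ^r ⊆ S`. -/
def IsConductor {r : ℕ} (S : AddSubmonoid (Fin r → ℕ)) (δ : Fin r → ℕ) : Prop :=
  IsLeast {c : Fin r → ℕ | ∀ v, c + v ∈ S} δ

/-- There is a saturated chain `α = c 0 < c 1 < ⋯ < c m = β` in `S` (no element of `S` can be
inserted). -/
def HasSaturatedChain {r : ℕ} (S : AddSubmonoid (Fin r → ℕ)) (α β : Fin r → ℕ) (m : ℕ) : Prop :=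
  ∃ c : ℕ → Fin r → ℕ, c 0 = α ∧ c m = β ∧ (∀ q ≤ m, c q ∈ S) ∧
    ∀ q < m, c q < c (q + 1) ∧ ∀ s ∈ S, ¬ (c q < s ∧ s < c (q + 1))

/-- The genus of `S` is `n`: with `δ` the conductor and `C = δ + ℕ^r`,
`n = d(ℕ^r ∖ C) - d(S ∖ C)`, where `d(ℕ^r ∖ C)` and `d(S ∖ C)` are the lengths of saturated chains
from `0` to `δ` in `ℕ^r` and in `S`. -/
def HasGenus {r : ℕ} (S : AddSubmonoid (Fin r → ℕ)) (n : ℕ) : Prop :=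
  ∃ (δ : Fin r → ℕ) (m₁ m₂ : ℕ), IsConductor S δ ∧ HasSaturatedChain ⊤ 0 δ m₁ ∧
    HasSaturatedChain S 0 δ m₂ ∧ (n : ℤ) = (m₁ : ℤ) - (m₂ : ℤ)

/-! ### Trees of vectors with `r` branches -/

/-- A family of nodes for a tree with `r` infinite branches: `T i j` is the node of the `i`-th
branch on level `j + 1` (levels are counted from `1`, indices `j` from `0`). Two branches are
glued on a level when they have the same node there. -/
abbrev VecTree (r : ℕ) : Type := Fin r → ℕ → (Fin r → ℕ)

/-- The nodes form a tree with a single root whose vectors record the branches through a node. -/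
structure IsVecTree {r : ℕ} (T : VecTree r) : Prop where
  root : ∀ i h, T i 0 = T h 0
  parent : ∀ i h j, T i (j + 1) = T h (j + 1) → T i j = T h j
  support : ∀ i j h, T i j h = 0 ↔ T i j ≠ T h j

/-- `N` is (the node set of) a finite subtree of `T` rooted in the root of `T`. A node is recorded
together with its level index, since the same vector may occur on several levels. -/
def IsRootedSubtree {r : ℕ} (T : VecTree r) (N : Finset (ℕ × (Fin r → ℕ))) : Prop :=
  (∃ i, (0, T i 0) ∈ N) ∧ (∀ x ∈ N, ∃ i, x.2 = T i x.1) ∧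
    ∀ i j, (j + 1, T i (j + 1)) ∈ N → (j, T i j) ∈ N

/-- `{0}` together with all sums of the nodes of finite rooted subtrees of `T`. -/
def subtreeSums {r : ℕ} (T : VecTree r) : Set (Fin r → ℕ) :=
  {0} ∪ {v | ∃ N, IsRootedSubtree T N ∧ v = ∑ x ∈ N, x.2}

/-- `T` is the multiplicity tree of `S`. -/
def IsMultiplicityTreeOf {r : ℕ} (T : VecTree r) (S : AddSubmonoid (Fin r → ℕ)) : Prop :=
  IsVecTree T ∧ (S : Set (Fin r → ℕ)) = subtreeSums T

/-- `T` is untwisted: two branches are glued on a level if and only if all consecutive branches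
between them are glued there. -/
def IsUntwisted {r : ℕ} (T : VecTree r) : Prop :=
  ∀ i h : Fin r, i < h → ∀ j, T i j = T h j ↔
    ∀ (k : ℕ) (hk : k + 1 < r), (i : ℕ) ≤ k → k < (h : ℕ) →
      T ⟨k, by omega⟩ j = T ⟨k + 1, hk⟩ j

/-- `Gen(r,n)`: the untwisted multiplicity trees of the local Arf good semigroups of `ℕ^r` with
genus `n`. -/
def Gen (r n : ℕ) : Set (VecTree r) :=
  {T | IsUntwisted T ∧ ∃ S : AddSubmonoid (Fin r → ℕ),
    IsLocalArfGood S ∧ IsMultiplicityTreeOf T S ∧ HasGenus S n}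

/-! ### The description of untwisted trees by sequences and gluing levels -/

/-- The untwisted tree `T_E = (p_1, …, p_{r-1})`, `E = {M_1, …, M_r}`. Here `E h j = M_{h+1}[j+1]`
and `p k = p_{k+1}` is the highest level on which the branches with indices `k`, `k + 1` are
glued. The node of branch `i` on level `j + 1` has `h`-th coordinate `E h j` if the branches `i`
and `h` are glued on that level, that is, `j + 1` is at most the minimum of the levels `p k`
between them, and `0` otherwise. -/
def treeOf {r : ℕ} (E : Fin r → ℕ → ℕ) (p : Fin (r - 1) → ℕ) : VecTree r :=
  open Classical in fun i j h =>
    if ∀ k : Fin (r - 1), min (i : ℕ) h ≤ k → (k : ℕ) < max (i : ℕ) h → j + 1 ≤ p k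
    then E h j else 0

/-- For a multiplicity sequence `M` (with `M j = M[j+1]`), the integer `s` such that
`M[j+1] = M[j+2] + ⋯ + M[s]`. -/
noncomputable def sumEnd (M : ℕ → ℕ) (j : ℕ) : ℕ :=
  sInf {s | M j = ∑ l ∈ Finset.Ico (j + 1) s, M l}

/-- The compatibility `Comp(M, M')` of two multiplicity sequences. -/
noncomputable def Comp (M M' : ℕ → ℕ) : ℕ∞ :=
  open Classical in
  if M = M' then ⊤
  else sInf {c : ℕ∞ | ∃ j, sumEnd M j ≠ sumEnd M' j ∧ c = (min (sumEnd M j) (sumEnd M' j) : ℕ)}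

/-- The set `I_r^n(t,p,k)` of the trees `T_E = (p_1, …, p_{r-1})` with
`T_{E_t} = (p_1, …, p_{t-1}) ∈ Gen(t,k)`, `T_{E^t} = (p_{t+1}, …, p_{r-1}) ∈ Gen(r-t,n-p-k)` and
`p_t = p ≤ Comp(M_t, M_{t+1})`, where `E_t = {M_1, …, M_t}` and `E^t = {M_{t+1}, …, M_r}`. -/
def glueSet (r n t : ℕ) (ht : 1 ≤ t) (htr : t < r) (p k : ℕ) : Set (VecTree r) :=
  {T | ∃ (E : Fin r → ℕ → ℕ) (q : Fin (r - 1) → ℕ), T = treeOf E q ∧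
    treeOf (fun i : Fin t => E ⟨i, by omega⟩)
      (fun l : Fin (t - 1) => q ⟨l, by omega⟩) ∈ Gen t k ∧
    treeOf (fun i : Fin (r - t) => E ⟨t + i, by omega⟩)
      (fun l : Fin (r - t - 1) => q ⟨t + l, by omega⟩) ∈ Gen (r - t) (n - p - k) ∧
    q ⟨t - 1, by omega⟩ = p ∧
    (p : ℕ∞) ≤ Comp (E ⟨t - 1, by omega⟩) (E ⟨t, htr⟩)}

end ArfGenus

/-! Membership in `Gen r n` turns out to depend only on single sequences and on consecutive pairs. A
tree lies in `Gen r n` exactly when it is `treeOf E q` with each `E i` a multiplicity sequence, 1 ≤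
q_k ≤ Comp(M_k, M_{k+1}) for all k, and n = ∑_i ∑_j (M_i[j] - 1) + ∑_k q_k (`treeOf_mem_gen_iff`,
`exists_eq_treeOf`). Cutting between branches t and t + 1 separates these conditions into those of
the two halves and one condition on q_t, and makes the genus additive up to q_t. The ranges of p and
k only express that a half with m branches has genus at least m - 1, because each gluing level is at
least 1.

For the characterization, a finite rooted subtree is encoded by the vector L of the levels at which
its branches are cut. `Admissible` says that glued branches are cut compatibly, and L ↦ `treeSum T
L` is an order embedding whose image on admissible L is S. The Arf property, applied to a full level
cut and the node vector of the next level, shows that the vectors `sumEnd` are admissible; on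
consecutive branches this is the bound by Comp. Conversely these data suffice for closure under K₁ +
K₂ - L (`IsArfTree.exists_add`), by descending recursion from the levels where all branches are
separate with multiplicity one.

For the genus, a saturated chain in S adds one node at a time, so its length is a number of nodes.
On each level, nodes and glued consecutive pairs together number r; summing over levels produces the
term ∑ q_k. -/

namespace ArfGenus

/-! ### Partial sums of a multiplicity sequence -/

/-- The sum of the first `l` terms of `M`. -/
def partialSum (M : ℕ → ℕ) (l : ℕ) : ℕ := ∑ j ∈ Finset.range l, M j

@[simp] lemma partialSum_zero (M : ℕ → ℕ) : partialSum M 0 = 0 := rfl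

lemma partialSum_succ (M : ℕ → ℕ) (l : ℕ) : partialSum M (l + 1) = partialSum M l + M l :=
  Finset.sum_range_succ _ _

lemma strictMono_partialSum {M : ℕ → ℕ} (hM : ∀ j, 0 < M j) : StrictMono (partialSum M) :=
  strictMono_nat_of_lt_succ fun l => by rw [partialSum_succ]; have := hM l; omega

lemma partialSum_add_of_tail {M : ℕ → ℕ} {N : ℕ} (hN : ∀ j, N ≤ j → M j = 1) {l : ℕ}
    (hl : N ≤ l) (d : ℕ) : partialSum M (l + d) = partialSum M l + d := by
  induction d with
  | zero => rfl
  | succ d ih => rw [← add_assoc, partialSum_succ, ih, hN _ (by omega)]; omega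

lemma partialSum_eq_add_sum_Ico (M : ℕ → ℕ) {l s : ℕ} (h : l ≤ s) :
    partialSum M s = partialSum M l + ∑ j ∈ Finset.Ico l s, M j :=
  (Finset.sum_range_add_sum_Ico M h).symm

/-- Positivity leaves at most one end index, so the infimum in `sumEnd` is over a singleton. If no
end index exists, `sumEnd` is 0, where `partialSum` vanishes; hence the equation `IsMultSeq.sum_eq`,
with its positive right-hand side, does assert existence. -/
lemma sumEnd_eq {M : ℕ → ℕ} (hM : ∀ j, 0 < M j) {j s : ℕ}
    (hs : partialSum M s = partialSum M (j + 1) + M j) : sumEnd M j = s := by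
  have key : {s | M j = ∑ l ∈ Finset.Ico (j + 1) s, M l} = {s} := by
    ext s'
    simp only [Set.mem_ofPred_eq, Set.mem_singleton_iff]
    constructor
    · intro h
      have hj := hM j
      have hle : j + 1 ≤ s' := by
        by_contra hlt
        rw [Finset.Ico_eq_empty_of_le (by omega), Finset.sum_empty] at h
        omega
      apply (strictMono_partialSum hM).injective
      rw [hs, partialSum_eq_add_sum_Ico M hle, ← h]
    · rintro rfl
      have hj := hM j
      have hle : j + 1 ≤ s' := ((strictMono_partialSum hM).lt_iff_lt.1 (by omega)).le
      rw [partialSum_eq_add_sum_Ico M hle] at hs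
      omega
  rw [sumEnd, key, csInf_singleton]

/-- Two levels agree on the levels singled out by `G`. -/
def LevelsAgree (G : ℕ → Prop) (k k' : ℕ) : Prop := ∀ l, G l → (l < k ↔ l < k')

/-- When two ends differ, the smaller one is itself a level that separates them, so agreement below
`p` forces `p` to be at most that end. This form of Comp is the one that matches `Admissible`. -/
lemma le_comp_iff (M M' : ℕ → ℕ) (p : ℕ) :
    (p : ℕ∞) ≤ Comp M M' ↔ ∀ j, LevelsAgree (· < p) (sumEnd M j) (sumEnd M' j) := by
  unfold Comp LevelsAgree
  split_ifs with h
  · subst h; simp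
  · constructor
    · intro hp j l hl
      by_cases hs : sumEnd M j = sumEnd M' j
      · rw [hs]
      · have := hp.trans (sInf_le ⟨j, hs, rfl⟩)
        have : p ≤ min (sumEnd M j) (sumEnd M' j) := by exact_mod_cast this
        omega
    · intro H
      refine le_sInf ?_
      rintro c ⟨j, hs, rfl⟩
      have h1 := H j (sumEnd M j)
      have h2 := H j (sumEnd M' j)
      have : p ≤ min (sumEnd M j) (sumEnd M' j) := by omega
      exact_mod_cast this

/-- A multiplicity sequence: positive, eventually one, each term a sum of consecutive
subsequent terms. -/
structure IsMultSeq (M : ℕ → ℕ) : Prop where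
  pos : ∀ j, 0 < M j
  tail : ∃ N, ∀ j, N ≤ j → M j = 1
  sum_eq : ∀ j, partialSum M (sumEnd M j) = partialSum M (j + 1) + M j

/-- Descending induction on `l` from the region of ones. With P = `partialSum M` and s = `sumEnd M
l`, one has P(s) - P(l+1) = M l. Hence P(k) + P(k') - P(l) arises by two additions relative to l +
1: first k with k', then the result with s. -/
lemma IsMultSeq.exists_add {M : ℕ → ℕ} (hM : IsMultSeq M) {l k k' : ℕ} (hk : l ≤ k)
    (hk' : l ≤ k') : ∃ k'', l ≤ k'' ∧
      partialSum M k + partialSum M k' = partialSum M k'' + partialSum M l := by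
  obtain ⟨N, hN⟩ := hM.tail
  obtain ⟨d, hd⟩ : ∃ d, N ≤ l + d := ⟨N, by omega⟩
  induction d generalizing l k k' with
  | zero =>
    obtain ⟨a, rfl⟩ := Nat.exists_eq_add_of_le hk
    obtain ⟨b, rfl⟩ := Nat.exists_eq_add_of_le hk'
    refine ⟨l + (a + b), by omega, ?_⟩
    have hl : N ≤ l := hd
    simp only [partialSum_add_of_tail hN hl]
    omega
  | succ d ih =>
    rcases hk.eq_or_lt with rfl | hk
    · exact ⟨k', hk', by omega⟩
    rcases hk'.eq_or_lt with rfl | hk'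
    · exact ⟨k, hk.le, by omega⟩
    have hs := hM.sum_eq l
    have hl := hM.pos l
    have hls : l + 1 ≤ sumEnd M l :=
      ((strictMono_partialSum hM.pos).lt_iff_lt.1 (by omega)).le
    obtain ⟨a, ha, ha'⟩ := ih (l := l + 1) hk hk' (by omega)
    obtain ⟨b, hb, hb'⟩ := ih hls ha (by omega)
    have := partialSum_succ M l
    exact ⟨b, by omega, by omega⟩

/-- Agreement of levels is preserved by the addition of partial sums above a common level. -/
lemma IsMultSeq.levelsAgree_add {M M' : ℕ → ℕ} (hM : IsMultSeq M) (hM' : IsMultSeq M')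
    {G : ℕ → Prop} (hG : ∀ j, G (j + 1) → G j) {N : ℕ} (hN : ¬ G N)
    (hs : ∀ j, LevelsAgree G (sumEnd M j) (sumEnd M' j)) {l k₁ k₂ k₃ m₁ m₂ m₃ : ℕ}
    (hk₁ : l ≤ k₁) (hk₂ : l ≤ k₂) (hm₁ : l ≤ m₁) (hm₂ : l ≤ m₂)
    (h₁ : LevelsAgree G k₁ m₁) (h₂ : LevelsAgree G k₂ m₂)
    (hk : partialSum M k₁ + partialSum M k₂ = partialSum M k₃ + partialSum M l)
    (hm : partialSum M' m₁ + partialSum M' m₂ = partialSum M' m₃ + partialSum M' l) :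
    LevelsAgree G k₃ m₃ := by
  have mono := strictMono_partialSum hM.pos
  have mono' := strictMono_partialSum hM'.pos
  have anti : ∀ a d, G (a + d) → G a := by
    intro a d
    induction d with
    | zero => exact id
    | succ d ih => exact fun h => ih (hG _ h)
  -- If `l` is outside `G`, every level in `G` lies below `l`, while `k₃` and `m₃` are at least `l`;
  -- both sides of the equivalence then hold.
  have triv : ∀ {l k₁ k₂ k₃ m₁ m₂ m₃ : ℕ}, l ≤ k₁ → l ≤ k₂ → l ≤ m₁ → l ≤ m₂ →
      partialSum M k₁ + partialSum M k₂ = partialSum M k₃ + partialSum M l →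
      partialSum M' m₁ + partialSum M' m₂ = partialSum M' m₃ + partialSum M' l → ¬ G l →
      LevelsAgree G k₃ m₃ := by
    intro l k₁ k₂ k₃ m₁ m₂ m₃ hk₁ hk₂ hm₁ hm₂ hk hm hGl x hx
    have hxl : x < l := by
      by_contra hlx
      obtain ⟨d, rfl⟩ := Nat.exists_eq_add_of_le (not_lt.1 hlx)
      exact hGl (anti _ _ hx)
    have a1 := mono.monotone hk₁
    have a2 := mono.monotone hk₂
    have a3 := mono'.monotone hm₁
    have a4 := mono'.monotone hm₂
    have h3 : l ≤ k₃ := mono.le_iff_le.1 (by omega)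
    have h4 : l ≤ m₃ := mono'.le_iff_le.1 (by omega)
    omega
  obtain ⟨d, hd⟩ : ∃ d, N ≤ l + d := ⟨N, by omega⟩
  induction d generalizing l k₁ k₂ k₃ m₁ m₂ m₃ with
  | zero =>
    refine triv hk₁ hk₂ hm₁ hm₂ hk hm fun h => hN ?_
    obtain ⟨e, rfl⟩ := Nat.exists_eq_add_of_le hd
    exact anti _ _ h
  | succ d ih =>
    by_cases hGl : G l
    swap
    · exact triv hk₁ hk₂ hm₁ hm₂ hk hm hGl
    have e1 := h₁ l hGl
    have e2 := h₂ l hGl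
    by_cases c1 : l < k₁
    swap
    · obtain rfl : l = k₁ := by omega
      obtain rfl : l = m₁ := by omega
      obtain rfl : k₂ = k₃ := mono.injective (by omega)
      obtain rfl : m₂ = m₃ := mono'.injective (by omega)
      exact h₂
    by_cases c2 : l < k₂
    swap
    · obtain rfl : l = k₂ := by omega
      obtain rfl : l = m₂ := by omega
      obtain rfl : k₁ = k₃ := mono.injective (by omega)
      obtain rfl : m₁ = m₃ := mono'.injective (by omega)
      exact h₁
    have d1 := e1.1 c1
    have d2 := e2.1 c2
    have hsl := hM.sum_eq l
    have hsl' := hM'.sum_eq l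
    have hl := hM.pos l
    have hl' := hM'.pos l
    have hls : l + 1 ≤ sumEnd M l := (mono.lt_iff_lt.1 (by omega)).le
    have hls' : l + 1 ≤ sumEnd M' l := (mono'.lt_iff_lt.1 (by omega)).le
    obtain ⟨a, ha, ha'⟩ := hM.exists_add (l := l + 1) c1 c2
    obtain ⟨b, hb, hb'⟩ := hM.exists_add hls ha
    obtain ⟨a₂, ha₂, ha₂'⟩ := hM'.exists_add (l := l + 1) d1 d2
    obtain ⟨b₂, hb₂, hb₂'⟩ := hM'.exists_add hls' ha₂
    have s1 := partialSum_succ M l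
    have s2 := partialSum_succ M' l
    obtain rfl : b = k₃ := mono.injective (by omega)
    obtain rfl : b₂ = m₃ := mono'.injective (by omega)
    -- The two-step recursion of `IsMultSeq.exists_add` runs in parallel for `M` and `M'`; the
    -- hypothesis `hs l` supplies the agreement of the ends used in the outer step.
    exact ih hls ha hls' ha₂ (hs l) (ih c1 c2 d1 d2 h₁ h₂ ha' ha₂' (by omega)) hb' hb₂' (by omega)

/-! ### Lengths of saturated chains -/

/-- Rank-function argument: by saturation the element of rank one higher given by `hstep` must be
the next term of the chain. Conversely, climbing by `hstep` gives a saturated chain, as nothing fits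
between consecutive ranks. -/
lemma hasSaturatedChain_iff {r : ℕ} (S : AddSubmonoid (Fin r → ℕ)) (ρ : (Fin r → ℕ) → ℕ)
    (h0 : ρ 0 = 0) (hmono : ∀ a ∈ S, ∀ b ∈ S, a < b → ρ a < ρ b)
    (hstep : ∀ a ∈ S, ∀ b ∈ S, a < b → ∃ c ∈ S, a < c ∧ c ≤ b ∧ ρ c = ρ a + 1)
    {β : Fin r → ℕ} (hβ : β ∈ S) (m : ℕ) : HasSaturatedChain S 0 β m ↔ m = ρ β := by
  constructor
  · rintro ⟨c, c0, cm, hc, hsat⟩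
    have key : ∀ q ≤ m, ρ (c q) = q := by
      intro q
      induction q with
      | zero => intro _; rw [c0, h0]
      | succ q ih =>
        intro hq
        obtain ⟨hlt, hno⟩ := hsat q (by omega)
        obtain ⟨x, hx, hax, hxb, hρ⟩ := hstep _ (hc q (by omega)) _ (hc _ hq) hlt
        rcases hxb.eq_or_lt with rfl | hxb
        · rw [hρ, ih (by omega)]
        · exact absurd ⟨hax, hxb⟩ (hno x hx)
    rw [← cm, key m le_rfl]
  · rintro rfl
    have key : ∀ d ≤ ρ β, ∃ γ ∈ S, γ ≤ β ∧ ρ γ = d ∧ HasSaturatedChain S 0 γ d := by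
      intro d
      induction d with
      | zero =>
        intro _
        exact ⟨0, S.zero_mem, zero_le, h0, fun _ => 0, rfl, rfl, fun _ _ => S.zero_mem,
          fun q hq => absurd hq (by omega)⟩
      | succ d ih =>
        intro hd
        obtain ⟨γ, hγ, hγβ, hρ, c, c0, cm, hc, hsat⟩ := ih (by omega)
        have hlt : γ < β := lt_of_le_of_ne hγβ (by rintro rfl; omega)
        obtain ⟨x, hx, hax, hxb, hρx⟩ := hstep _ hγ _ hβ hlt
        refine ⟨x, hx, hxb, by omega, fun q => if q ≤ d then c q else x, by simp [c0], by simp,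
          ?_, ?_⟩
        · intro q _
          dsimp only
          split_ifs with h
          · exact hc q h
          · exact hx
        · intro q hq
          rcases Nat.lt_succ_iff_lt_or_eq.1 hq with h | rfl
          · have h1 : q ≤ d := h.le
            have h2 : q + 1 ≤ d := h
            simpa [h1, h2] using hsat q h
          · simp only [le_refl, if_true, add_le_iff_nonpos_right, nonpos_iff_eq_zero,
              one_ne_zero, if_false, cm]
            refine ⟨hax, fun s hs ⟨h1, h2⟩ => ?_⟩
            have := hmono _ hγ _ hs h1
            have := hmono _ hs _ hx h2
            omega
    obtain ⟨γ, hγ, hγβ, hρ, hch⟩ := key _ le_rfl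
    rcases hγβ.eq_or_lt with rfl | hlt
    · exact hch
    · exact absurd (hmono _ hγ _ hβ hlt) (by omega)

lemma hasSaturatedChain_top_iff {r : ℕ} (β : Fin r → ℕ) (m : ℕ) :
    HasSaturatedChain ⊤ 0 β m ↔ m = ∑ i, β i := by
  refine hasSaturatedChain_iff ⊤ (fun v => ∑ i, v i) (by simp) ?_ ?_ trivial m
  · intro a _ b _ hab
    obtain ⟨hle, i, hi⟩ := Pi.lt_def.1 hab
    exact Finset.sum_lt_sum (fun i _ => hle i) ⟨i, Finset.mem_univ _, hi⟩
  · intro a _ b _ hab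
    obtain ⟨hle, i, hi⟩ := Pi.lt_def.1 hab
    refine ⟨a + Pi.single i 1, trivial, ?_, ?_, ?_⟩
    · refine Pi.lt_def.2 ⟨fun j => by simp, i, by simp⟩
    · intro j
      by_cases h : j = i
      · subst h; simpa using hi
      · simpa [h] using hle j
    · simp [Finset.sum_add_distrib]

lemma exists_isConductor {r : ℕ} {S : AddSubmonoid (Fin r → ℕ)} (hS : IsGoodSemigroup S) :
    ∃ δ, IsConductor S δ := by
  obtain ⟨δ₀, -, h₀⟩ := hS.exists_conductor
  obtain ⟨δ, hδ, hmin⟩ := wellFounded_lt.has_min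
    {c : Fin r → ℕ | ∀ v, c + v ∈ S} ⟨δ₀, h₀⟩
  refine ⟨δ, hδ, fun c hc => ?_⟩
  have hmem : δ ⊓ c ∈ {c : Fin r → ℕ | ∀ v, c + v ∈ S} := by
    intro v
    -- Subtraction is truncated: the two elements are max(δ, w) and max(c, w) with w = δ ⊓ c + v,
    -- and their minimum is w.
    have h1 := hδ (δ ⊓ c + v - δ)
    have h2 := hc (δ ⊓ c + v - c)
    convert hS.min_mem _ h1 _ h2 using 1
    ext i
    simp only [Pi.add_apply, Pi.inf_apply, Pi.sub_apply]
    omega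
  by_contra hne
  exact hmin _ hmem (lt_of_le_of_ne inf_le_left fun h => hne (inf_eq_left.1 h))

/-! ### Level vectors of a tree -/

/-- The multiplicity sequence of the `i`-th branch. -/
def branchSeq {r : ℕ} (T : VecTree r) (i : Fin r) (j : ℕ) : ℕ := T i j i

/-- The vectors `L` such that cutting the `i`-th branch after `L i` nodes gives a subtree. -/
def Admissible {r : ℕ} (T : VecTree r) (L : Fin r → ℕ) : Prop :=
  ∀ i h, LevelsAgree (fun j => T i j = T h j) (L i) (L h)

/-- The subtree given by a vector of levels. -/
def nodes {r : ℕ} (T : VecTree r) (L : Fin r → ℕ) : Finset (ℕ × (Fin r → ℕ)) :=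
  Finset.univ.biUnion fun i => (Finset.range (L i)).image fun j => (j, T i j)

/-- The sum of the nodes of the subtree given by a vector of levels. -/
def treeSum {r : ℕ} (T : VecTree r) (L : Fin r → ℕ) (i : Fin r) : ℕ :=
  partialSum (branchSeq T i) (L i)

section

variable {r : ℕ} {T : VecTree r}

lemma mem_nodes {L : Fin r → ℕ} {x : ℕ × (Fin r → ℕ)} :
    x ∈ nodes T L ↔ ∃ i, x.1 < L i ∧ x.2 = T i x.1 := by
  simp only [nodes, Finset.mem_biUnion, Finset.mem_univ, true_and, Finset.mem_image,
    Finset.mem_range]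
  constructor
  · rintro ⟨i, j, hj, rfl⟩; exact ⟨i, hj, rfl⟩
  · rintro ⟨i, hi, h⟩; exact ⟨i, x.1, hi, by rw [← h]⟩

lemma Admissible.mem_nodes_iff {L : Fin r → ℕ} (hL : Admissible T L) (i : Fin r) (j : ℕ) :
    (j, T i j) ∈ nodes T L ↔ j < L i := by
  rw [mem_nodes]
  constructor
  · rintro ⟨h, h1, h2⟩; exact (hL i h j h2).2 h1
  · intro h; exact ⟨i, h, rfl⟩

lemma Admissible.inf {L L' : Fin r → ℕ} (hL : Admissible T L) (hL' : Admissible T L') :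
    Admissible T (L ⊓ L') := by
  intro i h j hj
  have := hL i h j hj
  have := hL' i h j hj
  simp only [Pi.inf_apply]
  omega

lemma admissible_const (N : ℕ) : Admissible T fun _ => N := fun _ _ _ _ => Iff.rfl

lemma IsVecTree.branchSeq_pos (hT : IsVecTree T) (i : Fin r) (j : ℕ) : 0 < branchSeq T i j :=
  Nat.pos_of_ne_zero fun h => (hT.support i j i).1 h rfl

lemma IsVecTree.glued_of_le (hT : IsVecTree T) {i h : Fin r} {j l : ℕ} (hlj : l ≤ j)
    (hj : T i j = T h j) : T i l = T h l := by
  induction j, hlj using Nat.le_induction with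
  | base => exact hj
  | succ j _ ih => exact ih (hT.parent _ _ _ hj)

lemma IsVecTree.sum_nodes (hT : IsVecTree T) {L : Fin r → ℕ} (hL : Admissible T L) :
    ∑ x ∈ nodes T L, x.2 = treeSum T L := by
  ext i
  rw [Finset.sum_apply, treeSum, partialSum]
  have hsub : (Finset.range (L i)).image (fun j => (j, T i j)) ⊆ nodes T L := by
    intro x hx
    simp only [Finset.mem_image, Finset.mem_range] at hx
    obtain ⟨j, hj, rfl⟩ := hx
    exact (hL.mem_nodes_iff i j).2 hj
  rw [← Finset.sum_subset hsub, Finset.sum_image]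
  · rfl
  · intro a _ b _ hab; exact (Prod.mk.inj hab).1
  · rintro ⟨j, v⟩ hx hx'
    obtain ⟨h, hjh, hv⟩ := mem_nodes.1 hx
    dsimp only at hjh hv ⊢
    subst hv
    rw [hT.support]
    intro heq
    apply hx'
    simp only [Finset.mem_image, Finset.mem_range]
    exact ⟨j, (hL h i j heq).1 hjh, by rw [heq]⟩

lemma IsVecTree.strictMono_coord (hT : IsVecTree T) (i : Fin r) :
    StrictMono (partialSum (branchSeq T i)) :=
  strictMono_partialSum (hT.branchSeq_pos i)

lemma IsVecTree.treeSum_injective (hT : IsVecTree T) : Function.Injective (treeSum T) :=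
  fun _ _ h => funext fun i => (hT.strictMono_coord i).injective (congrFun h i)

lemma IsVecTree.treeSum_le_iff (hT : IsVecTree T) {L L' : Fin r → ℕ} :
    treeSum T L ≤ treeSum T L' ↔ L ≤ L' :=
  forall_congr' fun i => (hT.strictMono_coord i).le_iff_le

lemma IsVecTree.treeSum_lt_iff (hT : IsVecTree T) {L L' : Fin r → ℕ} :
    treeSum T L < treeSum T L' ↔ L < L' :=
  lt_iff_lt_of_le_iff_le' hT.treeSum_le_iff hT.treeSum_le_iff

lemma treeSum_zero : treeSum T 0 = 0 := rfl

lemma exists_eq_nodes {N : Finset (ℕ × (Fin r → ℕ))} (hN : IsRootedSubtree T N) :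
    ∃ L, Admissible T L ∧ N = nodes T L := by
  classical
  have hex : ∀ i, ∃ j, (j, T i j) ∉ N := by
    intro i
    by_contra! h
    have : Set.Infinite (N : Set (ℕ × (Fin r → ℕ))) :=
      Set.infinite_of_injective_forall_mem (f := fun j => (j, T i j))
        (fun a b hab => (Prod.mk.inj hab).1) h
    exact this N.finite_toSet
  have hdown : ∀ i j l, l ≤ j → (j, T i j) ∈ N → (l, T i l) ∈ N := by
    intro i j l hlj
    induction j, hlj using Nat.le_induction with
    | base => exact id
    | succ j _ ih => exact fun h => ih (hN.2.2 i j h)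
  have hL : ∀ i j, j < Nat.find (hex i) ↔ (j, T i j) ∈ N := by
    intro i j
    constructor
    · intro h; exact not_not.1 (Nat.find_min (hex i) h)
    · intro h
      by_contra hlt
      exact Nat.find_spec (hex i) (hdown i j _ (not_lt.1 hlt) h)
  -- Each branch is cut at its first node outside `N`.
  refine ⟨fun i => Nat.find (hex i), ?_, ?_⟩
  · intro i h j hj
    rw [hL, hL, hj]
  · ext ⟨j, v⟩
    rw [mem_nodes]
    dsimp only
    constructor
    · intro hx
      obtain ⟨i, hi⟩ := hN.2.1 _ hx
      dsimp only at hi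
      exact ⟨i, (hL i j).2 (hi ▸ hx), hi⟩
    · rintro ⟨i, h1, rfl⟩
      exact (hL i j).1 h1

lemma IsVecTree.subtreeSums_eq (hT : IsVecTree T) :
    subtreeSums T = {v | ∃ L, Admissible T L ∧ treeSum T L = v} := by
  ext v
  simp only [subtreeSums, Set.mem_union, Set.mem_singleton_iff, Set.mem_ofPred_eq]
  constructor
  · rintro (rfl | ⟨N, hN, rfl⟩)
    · exact ⟨0, admissible_const 0, rfl⟩
    · obtain ⟨L, hL, rfl⟩ := exists_eq_nodes hN
      exact ⟨L, hL, (hT.sum_nodes hL).symm⟩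
  · rintro ⟨L, hL, rfl⟩
    by_cases h0 : L = 0
    · subst h0; exact Or.inl rfl
    · obtain ⟨i, hi⟩ := Function.ne_iff.1 h0
      refine Or.inr ⟨nodes T L, ⟨⟨i, ?_⟩, ?_, ?_⟩, (hT.sum_nodes hL).symm⟩
      · exact (hL.mem_nodes_iff i 0).2 (Nat.pos_of_ne_zero hi)
      · intro x hx
        obtain ⟨h, -, hx⟩ := mem_nodes.1 hx
        exact ⟨h, hx⟩
      · intro h j hj
        rw [hL.mem_nodes_iff] at hj ⊢
        omega

/-- Adding the node of the `i`-th branch on its first missing level. -/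
lemma IsVecTree.exists_step (hT : IsVecTree T) {L : Fin r → ℕ} (hL : Admissible T L) (i : Fin r) :
    ∃ L', Admissible T L' ∧ nodes T L' = insert (L i, T i (L i)) (nodes T L) ∧
      ∀ h, (T i (L i) = T h (L i) → L h = L i ∧ L' h = L i + 1) ∧
        (T i (L i) ≠ T h (L i) → L' h = L h) := by
  classical
  have hcl : ∀ h, T i (L i) = T h (L i) → L h = L i := by
    intro h hh
    have h1 := hL i h (L i) hh
    by_contra hne
    have hlt : L h < L i := by omega
    have := hL i h (L h) (hT.glued_of_le hlt.le hh)
    omega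
  let L' : Fin r → ℕ := fun h => if T i (L i) = T h (L i) then L i + 1 else L h
  have hL' : Admissible T L' := by
    intro a b j hj
    have e := hL a b j hj
    simp only [L']
    split_ifs with ha hb hb
    · rfl
    · have : j < L i := by
        by_contra hlt
        exact hb (ha.trans (hT.glued_of_le (not_lt.1 hlt) hj))
      rw [hcl a ha] at e
      omega
    · have : j < L i := by
        by_contra hlt
        exact ha (hb.trans (hT.glued_of_le (not_lt.1 hlt) hj).symm)
      rw [hcl b hb] at e
      omega
    · exact e
  refine ⟨L', hL', ?_, fun h => ⟨fun hh => ⟨hcl h hh, if_pos hh⟩, fun hh => if_neg hh⟩⟩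
  ext ⟨j, v⟩
  simp only [mem_nodes, Finset.mem_insert, Prod.mk.injEq]
  constructor
  · rintro ⟨h, h1, rfl⟩
    simp only [L'] at h1
    split_ifs at h1 with hh
    · rcases Nat.lt_succ_iff_lt_or_eq.1 h1 with h2 | rfl
      · exact Or.inr ⟨h, by rw [hcl h hh]; exact h2, rfl⟩
      · exact Or.inl ⟨rfl, hh.symm⟩
    · exact Or.inr ⟨h, h1, rfl⟩
  · rintro (⟨rfl, rfl⟩ | ⟨h, h1, rfl⟩)
    · exact ⟨i, by simp [L'], rfl⟩
    · refine ⟨h, ?_, rfl⟩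
      simp only [L']
      split_ifs with hh
      · rw [hcl h hh] at h1; omega
      · exact h1

lemma card_nodes_lt {L L' : Fin r → ℕ} (hL : Admissible T L) (hL' : Admissible T L')
    (h : L < L') : (nodes T L).card < (nodes T L').card := by
  apply Finset.card_lt_card
  obtain ⟨hle, i, hi⟩ := Pi.lt_def.1 h
  refine Finset.ssubset_iff_of_subset ?_ |>.2
    ⟨(L i, T i (L i)), (hL'.mem_nodes_iff _ _).2 hi, fun hx => ?_⟩
  · intro x hx
    obtain ⟨h, h1, h2⟩ := mem_nodes.1 hx
    exact mem_nodes.2 ⟨h, h1.trans_le (hle h), h2⟩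
  · exact lt_irrefl _ ((hL.mem_nodes_iff _ _).1 hx)

lemma IsVecTree.hasSaturatedChain_iff (hT : IsVecTree T) {S : AddSubmonoid (Fin r → ℕ)}
    (hS : (S : Set (Fin r → ℕ)) = subtreeSums T) {L : Fin r → ℕ} (hL : Admissible T L) (m : ℕ) :
    HasSaturatedChain S 0 (treeSum T L) m ↔ m = (nodes T L).card := by
  have hmem : ∀ v, v ∈ S ↔ ∃ L, Admissible T L ∧ treeSum T L = v := by
    intro v
    rw [← SetLike.mem_coe, hS, hT.subtreeSums_eq]
    rfl
  have hinv : ∀ L, Function.invFun (treeSum T) (treeSum T L) = L :=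
    Function.leftInverse_invFun hT.treeSum_injective
  rw [ArfGenus.hasSaturatedChain_iff S
    (fun v => (nodes T (Function.invFun (treeSum T) v)).card) _ _ _ ((hmem _).2 ⟨L, hL, rfl⟩),
    hinv]
  · rw [← treeSum_zero (T := T), hinv]
    rw [Finset.card_eq_zero]
    ext x
    simp [mem_nodes]
  · intro a ha b hb hab
    obtain ⟨A, hA, rfl⟩ := (hmem a).1 ha
    obtain ⟨B, hB, rfl⟩ := (hmem b).1 hb
    rw [hinv, hinv]
    exact card_nodes_lt hA hB (hT.treeSum_lt_iff.1 hab)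
  · intro a ha b hb hab
    obtain ⟨A, hA, rfl⟩ := (hmem a).1 ha
    obtain ⟨B, hB, rfl⟩ := (hmem b).1 hb
    obtain ⟨hle, i, hi⟩ := Pi.lt_def.1 (hT.treeSum_lt_iff.1 hab)
    obtain ⟨C, hC, hnodes, hstep⟩ := hT.exists_step hA i
    refine ⟨treeSum T C, (hmem _).2 ⟨C, hC, rfl⟩, hT.treeSum_lt_iff.2 ?_,
      hT.treeSum_le_iff.2 ?_, ?_⟩
    · refine Pi.lt_def.2 ⟨fun h => ?_, i, ?_⟩
      · by_cases hh : T i (A i) = T h (A i)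
        · obtain ⟨h1, h2⟩ := (hstep h).1 hh
          rw [h1, h2]
          exact Nat.le_succ _
        · exact ((hstep h).2 hh).ge
      · have := (hstep i).1 rfl; omega
    · intro h
      by_cases hh : T i (A i) = T h (A i)
      · rw [((hstep h).1 hh).2]
        exact (hB i h _ hh).1 hi
      · rw [(hstep h).2 hh]; exact hle h
    · rw [hinv, hinv, hnodes, Finset.card_insert_of_notMem]
      rw [hA.mem_nodes_iff]
      exact lt_irrefl _

end

/-! ### Characterization of multiplicity trees -/

/-- The intrinsic conditions on a multiplicity tree of a local Arf good semigroup: from the level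
index `N` on the branches are separated and have multiplicity one, and each node is a sum of the
nodes of a finite subtree below it. -/
structure IsArfTree {r : ℕ} (T : VecTree r) (N : ℕ) : Prop where
  vecTree : IsVecTree T
  tail_one : ∀ i j, N ≤ j → branchSeq T i j = 1
  tail_unglued : ∀ i h j, N ≤ j → T i j = T h j → i = h
  sum_eq : ∀ j, ∃ K, Admissible T K ∧
    ∀ i, partialSum (branchSeq T i) (K i) = partialSum (branchSeq T i) (j + 1) + branchSeq T i j

section

variable {r : ℕ} {T : VecTree r} {S : AddSubmonoid (Fin r → ℕ)} {N : ℕ}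

lemma IsVecTree.mem_iff (hT : IsVecTree T) (hS : (S : Set (Fin r → ℕ)) = subtreeSums T)
    (v : Fin r → ℕ) : v ∈ S ↔ ∃ L, Admissible T L ∧ treeSum T L = v := by
  rw [← SetLike.mem_coe, hS, hT.subtreeSums_eq]
  rfl

/-- Above the conductor a single coordinate can be raised freely. Raising coordinate `i` to one more
than its partial sum at `j` forces the node to contribute 1; a branch glued to `i` at `j` would have
to grow too, although its coordinate is unchanged. -/
lemma IsVecTree.tail_of_conductor (hT : IsVecTree T)
    (hS : (S : Set (Fin r → ℕ)) = subtreeSums T) {D : Fin r → ℕ} (hD : Admissible T D)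
    (hcond : ∀ v, treeSum T D + v ∈ S) {i : Fin r} {j : ℕ} (hj : D i ≤ j) :
    branchSeq T i j = 1 ∧ ∀ h, T i j = T h j → i = h := by
  have mono := hT.strictMono_coord i
  have hle := mono.monotone hj
  obtain ⟨L, hL, hLv⟩ := (hT.mem_iff hS _).1 (hcond (Pi.single i
    (partialSum (branchSeq T i) j + 1 - partialSum (branchSeq T i) (D i))))
  have hi := congrFun hLv i
  simp only [treeSum, Pi.add_apply, Pi.single_eq_same] at hi
  have hlt : j < L i := mono.lt_iff_lt.1 (by omega)
  refine ⟨?_, fun h hh => ?_⟩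
  · have h1 := mono.monotone hlt
    have h2 := partialSum_succ (branchSeq T i) j
    have h3 := hT.branchSeq_pos i j
    simp only [Nat.succ_eq_add_one] at h1
    omega
  · by_contra hne
    have hLh := congrFun hLv h
    simp only [treeSum, Pi.add_apply, Pi.single_eq_of_ne (Ne.symm hne), add_zero] at hLh
    have hLh := (hT.strictMono_coord h).injective hLh
    have h1 := (hL i h j hh).1 hlt
    have h2 := (hD i h j hh).2 (hLh ▸ h1)
    omega

lemma IsVecTree.exists_isArfTree (hT : IsVecTree T)
    (hS : (S : Set (Fin r → ℕ)) = subtreeSums T) (hArf : IsLocalArfGood S) :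
    ∃ N, IsArfTree T N := by
  obtain ⟨δ, hδ, hcond⟩ := hArf.good.exists_conductor
  obtain ⟨D, hD, rfl⟩ := (hT.mem_iff hS δ).1 hδ
  have hle : ∀ i, D i ≤ ∑ i, D i := fun i =>
    Finset.single_le_sum (f := D) (fun _ _ => Nat.zero_le _) (Finset.mem_univ i)
  refine ⟨∑ i, D i, hT, fun i j hj => (hT.tail_of_conductor hS hD hcond ((hle i).trans hj)).1,
    fun i h j hj => (hT.tail_of_conductor hS hD hcond ((hle i).trans hj)).2 h, fun j => ?_⟩
  -- Arf property with α the cut at level `j` and x = y the vector of multiplicities at level `j`,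
  -- so that α + x is the cut at level `j + 1`.
  have h0 : treeSum T (fun _ => j) ∈ S := (hT.mem_iff hS _).2 ⟨_, admissible_const j, rfl⟩
  have h1 : treeSum T (fun _ => j) + (fun i => branchSeq T i j) ∈ S := by
    refine (hT.mem_iff hS _).2 ⟨_, admissible_const (j + 1), ?_⟩
    ext i
    exact partialSum_succ _ _
  obtain ⟨K, hK, hKv⟩ := (hT.mem_iff hS _).1 (hArf.arf _ h0 _ _ h1 h1)
  refine ⟨K, hK, fun i => ?_⟩
  have := congrFun hKv i
  simp only [treeSum, Pi.add_apply] at this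
  rw [this, partialSum_succ, add_assoc]

lemma IsArfTree.isMultSeq (hT : IsArfTree T N) (i : Fin r) : IsMultSeq (branchSeq T i) := by
  refine ⟨hT.vecTree.branchSeq_pos i, ⟨N, hT.tail_one i⟩, fun j => ?_⟩
  obtain ⟨K, -, hK⟩ := hT.sum_eq j
  rw [sumEnd_eq (hT.vecTree.branchSeq_pos i) (hK i), hK i]

lemma IsArfTree.admissible_sumEnd (hT : IsArfTree T N) (j : ℕ) :
    Admissible T fun i => sumEnd (branchSeq T i) j := by
  obtain ⟨K, hK, hKs⟩ := hT.sum_eq j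
  convert hK using 2 with i
  exact sumEnd_eq (hT.vecTree.branchSeq_pos i) (hKs i)

lemma IsArfTree.exists_add (hT : IsArfTree T N) {L K₁ K₂ : Fin r → ℕ} (hL : Admissible T L)
    (hK₁ : Admissible T K₁) (hK₂ : Admissible T K₂) (h₁ : L ≤ K₁) (h₂ : L ≤ K₂) :
    ∃ K₃, Admissible T K₃ ∧ treeSum T K₁ + treeSum T K₂ = treeSum T K₃ + treeSum T L := by
  choose K₃ hle hK₃ using fun i => (hT.isMultSeq i).exists_add (h₁ i) (h₂ i)
  refine ⟨K₃, fun i h => ?_, funext hK₃⟩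
  by_cases hih : i = h
  · subst hih; exact fun _ _ => Iff.rfl
  -- Branches glued at the cut of `L` are cut there at the same level, so `levelsAgree_add` applies.
  -- Otherwise all their common levels lie below `L`, hence below `K₃`.
  by_cases hg : T i (L i) = T h (L i)
  · have hLh : L h = L i := by
      have e1 := hL i h (L i) hg
      by_contra hne
      have hlt : L h < L i := by omega
      have := hL i h (L h) (hT.vecTree.glued_of_le hlt.le hg)
      omega
    have hs₁ := h₁ h
    have hs₂ := h₂ h
    have hK := hK₃ h
    rw [hLh] at hs₁ hs₂ hK
    exact (hT.isMultSeq i).levelsAgree_add (hT.isMultSeq h)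
      (G := fun j => T i j = T h j) (fun j => hT.vecTree.parent i h j) (N := N)
      (fun hh => hih (hT.tail_unglued i h N le_rfl hh)) (fun j => hT.admissible_sumEnd j i h)
      (h₁ i) (h₂ i) hs₁ hs₂ (hK₁ i h) (hK₂ i h) (hK₃ i) hK
  · intro l hl
    have hlt : l < L i := by
      by_contra hlt
      exact hg (hT.vecTree.glued_of_le (not_lt.1 hlt) hl)
    have h3 := (hL i h l hl).1 hlt
    have := hle i
    have := hle h
    omega

/-- The semigroup of the subtree sums of an Arf tree. -/
def IsArfTree.semigroup (hT : IsArfTree T N) : AddSubmonoid (Fin r → ℕ) where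
  carrier := subtreeSums T
  zero_mem' := Or.inl rfl
  add_mem' := by
    intro a b ha hb
    rw [hT.vecTree.subtreeSums_eq] at ha hb ⊢
    obtain ⟨A, hA, rfl⟩ := ha
    obtain ⟨B, hB, rfl⟩ := hb
    obtain ⟨C, hC, h⟩ := hT.exists_add (admissible_const 0) hA hB (fun _ => Nat.zero_le _)
      (fun _ => Nat.zero_le _)
    refine ⟨C, hC, ?_⟩
    rw [h]
    rfl

lemma IsArfTree.exists_treeSum_eq (hT : IsArfTree T N) {v : Fin r → ℕ}
    (hv : treeSum T (fun _ => N) ≤ v) :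
    ∃ L, Admissible T L ∧ treeSum T L = v := by
  refine ⟨fun i => N + (v i - treeSum T (fun _ => N) i), ?_, ?_⟩
  · intro i h j hj
    by_cases hN : N ≤ j
    · rw [hT.tail_unglued i h j hN hj]
    · dsimp only
      omega
  · ext i
    have := hv i
    rw [treeSum, partialSum_add_of_tail (hT.tail_one i) le_rfl]
    simp only [treeSum] at this ⊢
    omega

lemma IsArfTree.isLocalArfGood (hT : IsArfTree T N) : IsLocalArfGood hT.semigroup := by
  have hmem := hT.vecTree.mem_iff (S := hT.semigroup) rfl
  refine ⟨⟨?_, ?_, ?_⟩, ?_, ?_⟩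
  · intro a ha b hb
    obtain ⟨A, hA, rfl⟩ := (hmem a).1 ha
    obtain ⟨B, hB, rfl⟩ := (hmem b).1 hb
    refine (hmem _).2 ⟨_, hA.inf hB, ?_⟩
    ext i
    exact (hT.vecTree.strictMono_coord i).monotone.map_min
  · intro a ha b hb i hi
    obtain ⟨A, hA, rfl⟩ := (hmem a).1 ha
    obtain ⟨B, hB, rfl⟩ := (hmem b).1 hb
    have hi' : A i = B i := (hT.vecTree.strictMono_coord i).injective hi
    have hmin : ∀ h, treeSum T (A ⊓ B) h = min (treeSum T A h) (treeSum T B h) := fun h =>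
      (hT.vecTree.strictMono_coord h).monotone.map_min
    -- The exchange element adds to the minimum the first missing node of branch `i`. It alters only
    -- branches through that node, and on those `A` and `B` agree.
    obtain ⟨C, hC, -, hstep⟩ := hT.vecTree.exists_step (hA.inf hB) i
    have hm : (A ⊓ B) i = A i := by simp [hi']
    rw [hm] at hstep
    refine ⟨treeSum T C, (hmem _).2 ⟨C, hC, rfl⟩, ?_, ?_, ?_⟩
    · refine hT.vecTree.strictMono_coord i ?_
      rw [((hstep i).1 rfl).2]
      exact Nat.lt_succ_self _
    · intro h _
      rw [← hmin]
      refine (hT.vecTree.strictMono_coord h).monotone ?_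
      by_cases hh : T i (A i) = T h (A i)
      · obtain ⟨e1, e2⟩ := (hstep h).1 hh
        rw [e1, e2]
        exact Nat.le_succ _
      · rw [(hstep h).2 hh]
    · intro h hne
      rw [← hmin]
      have hh : T i (A i) ≠ T h (A i) := by
        intro hh
        apply hne
        have h1 := hA i h (A i) hh
        have h2 := hB i h (A i) hh
        have h3 := ((hstep h).1 hh).1
        simp only [Pi.inf_apply] at h3
        have : A h = B h := by omega
        simp only [treeSum, this]
      simp only [treeSum, (hstep h).2 hh]
  · exact ⟨_, (hmem _).2 ⟨_, admissible_const N, rfl⟩, fun v =>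
      (hmem _).2 (hT.exists_treeSum_eq le_self_add)⟩
  · rintro a ha ⟨i, hi⟩
    obtain ⟨A, hA, rfl⟩ := (hmem a).1 ha
    have hi' : A i = 0 := (hT.vecTree.strictMono_coord i).injective hi
    ext h
    have : A h = 0 := by
      have := hA i h 0 (hT.vecTree.root i h)
      omega
    simp [treeSum, this]
  · intro a ha x y hx hy
    obtain ⟨A, hA, rfl⟩ := (hmem a).1 ha
    obtain ⟨X, hX, hX'⟩ := (hmem _).1 hx
    obtain ⟨Y, hY, hY'⟩ := (hmem _).1 hy
    obtain ⟨K, hK, hK'⟩ := hT.exists_add hA hX hY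
      (hT.vecTree.treeSum_le_iff.1 (by rw [hX']; exact le_self_add))
      (hT.vecTree.treeSum_le_iff.1 (by rw [hY']; exact le_self_add))
    refine (hmem _).2 ⟨K, hK, ?_⟩
    rw [hX', hY'] at hK'
    ext i
    have := congrFun hK' i
    simp only [Pi.add_apply] at this ⊢
    omega

/-! ### The genus -/

lemma card_nodes_of_tail {D L : Fin r → ℕ} (hD : Admissible T D) (hle : D ≤ L)
    (hsep : ∀ i h j, D i ≤ j → T i j = T h j → i = h) :
    (nodes T L).card = (nodes T D).card + ∑ i, (L i - D i) := by
  classical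
  have hsub : nodes T D ⊆ nodes T L := by
    intro x hx
    obtain ⟨h, h1, h2⟩ := mem_nodes.1 hx
    exact mem_nodes.2 ⟨h, h1.trans_le (hle h), h2⟩
  have hdiff : nodes T L \ nodes T D =
      (Finset.univ.sigma fun i => Finset.Ico (D i) (L i)).image fun x => (x.2, T x.1 x.2) := by
    ext ⟨j, v⟩
    simp only [Finset.mem_sdiff, Finset.mem_image, Finset.mem_sigma, Finset.mem_univ, true_and,
      Finset.mem_Ico, Prod.mk.injEq]
    constructor
    · rintro ⟨h1, h2⟩
      obtain ⟨i, hi, hv⟩ := mem_nodes.1 h1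
      dsimp only at hi hv
      subst hv
      rw [hD.mem_nodes_iff] at h2
      exact ⟨⟨i, j⟩, ⟨not_lt.1 h2, hi⟩, rfl, rfl⟩
    · rintro ⟨⟨i, j⟩, ⟨h1, h2⟩, rfl, rfl⟩
      rw [hD.mem_nodes_iff]
      exact ⟨mem_nodes.2 ⟨i, h2, rfl⟩, not_lt.2 h1⟩
  rw [← Finset.card_sdiff_add_card_eq_card hsub, hdiff, Finset.card_image_of_injOn,
    Finset.card_sigma, add_comm]
  · simp
  · rintro ⟨i, j⟩ hx ⟨h, l⟩ hy hxy
    simp only [Prod.mk.injEq] at hxy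
    obtain ⟨rfl, hxy⟩ := hxy
    simp only [Finset.coe_sigma, Set.mem_sigma_iff, Finset.coe_Ico, Set.mem_Ico] at hx
    obtain rfl := hsep i h j hx.2.1 hxy
    rfl

/-- The cut `D` of the conductor may be replaced by the constant cut `N`: beyond `D` each new node
is on one branch and has multiplicity one, so both chain lengths grow by ∑ (N - D i). -/
lemma IsArfTree.hasGenus_iff (hT : IsArfTree T N) (hS : (S : Set (Fin r → ℕ)) = subtreeSums T)
    (hgood : IsGoodSemigroup S) (n : ℕ) :
    HasGenus S n ↔
      n + (nodes T fun _ => N).card = ∑ i, partialSum (branchSeq T i) N := by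
  obtain ⟨δ, hδ⟩ := exists_isConductor hgood
  have hδS : δ ∈ S := by simpa using hδ.1 0
  obtain ⟨D, hD, rfl⟩ := (hT.vecTree.mem_iff hS δ).1 hδS
  have hDN : D ≤ fun _ => N := hT.vecTree.treeSum_le_iff.1
    (hδ.2 fun v => (hT.vecTree.mem_iff hS _).2 (hT.exists_treeSum_eq le_self_add))
  have htail := fun i j (hj : D i ≤ j) => hT.vecTree.tail_of_conductor hS hD hδ.1 hj
  have hcard := card_nodes_of_tail hD hDN fun i h j hj => (htail i j hj).2 h
  have hsum : ∑ i, partialSum (branchSeq T i) N = ∑ i, treeSum T D i + ∑ i, (N - D i) := by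
    rw [← Finset.sum_add_distrib]
    refine Finset.sum_congr rfl fun i _ => ?_
    rw [treeSum, ← partialSum_add_of_tail (fun j hj => (htail i j hj).1) le_rfl,
      Nat.add_sub_cancel' (hDN i)]
  rw [hcard, hsum]
  constructor
  · rintro ⟨δ', m₁, m₂, h1, h2, h3, h4⟩
    obtain rfl := h1.unique hδ
    rw [hasSaturatedChain_top_iff] at h2
    rw [hT.vecTree.hasSaturatedChain_iff hS hD] at h3
    omega
  · intro h
    exact ⟨_, _, _, hδ, (hasSaturatedChain_top_iff _ _).2 rfl,
      (hT.vecTree.hasSaturatedChain_iff hS hD _).2 rfl, by omega⟩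

end

lemma mem_gen_iff {r n : ℕ} {T : VecTree r} :
    T ∈ Gen r n ↔ IsUntwisted T ∧ ∃ N, IsArfTree T N ∧
      n + (nodes T fun _ => N).card = ∑ i, partialSum (branchSeq T i) N := by
  constructor
  · rintro ⟨hu, S, hArf, ⟨hT, hS⟩, hg⟩
    obtain ⟨N, hN⟩ := hT.exists_isArfTree hS hArf
    exact ⟨hu, N, hN, (hN.hasGenus_iff hS hArf.good n).1 hg⟩
  · rintro ⟨hu, N, hN, hg⟩
    exact ⟨hu, hN.semigroup, hN.isLocalArfGood, ⟨hN.vecTree, rfl⟩,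
      (hN.hasGenus_iff rfl hN.isLocalArfGood.good n).2 hg⟩

/-! ### Untwisted trees given by sequences and gluing levels -/

/-- The branches `i` and `h` of `treeOf E q` are glued on the level with index `j`. -/
def Glued {r : ℕ} (q : Fin (r - 1) → ℕ) (i h : Fin r) (j : ℕ) : Prop :=
  ∀ k : Fin (r - 1), min (i : ℕ) h ≤ k → (k : ℕ) < max (i : ℕ) h → j + 1 ≤ q k

/-- The contribution `∑ (M[j] - 1)` of a multiplicity sequence to the genus. -/
noncomputable def seqGenus (M : ℕ → ℕ) : ℕ := ∑ᶠ j, (M j - 1)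

lemma partialSum_eq_add_seqGenus {M : ℕ → ℕ} (hM : ∀ j, 0 < M j) {N : ℕ}
    (hN : ∀ j, N ≤ j → M j = 1) : partialSum M N = N + seqGenus M := by
  have h : seqGenus M = ∑ j ∈ Finset.range N, (M j - 1) := by
    apply finsum_eq_sum_of_support_subset
    intro j hj
    by_contra hlt
    simp only [Finset.coe_range, Set.mem_Iio, not_lt] at hlt
    exact hj (by simp [hN j hlt])
  have h2 : partialSum M N = ∑ j ∈ Finset.range N, (1 + (M j - 1)) :=
    Finset.sum_congr rfl fun j _ => by have := hM j; omega
  rw [h2, h, Finset.sum_add_distrib]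
  simp

section

variable {r : ℕ} {E : Fin r → ℕ → ℕ} {q : Fin (r - 1) → ℕ}

lemma Glued.refl (i : Fin r) (j : ℕ) : Glued q i i j := fun k _ _ => by omega

lemma Glued.symm {i h : Fin r} {j : ℕ} (hg : Glued q i h j) : Glued q h i j :=
  fun k h1 h2 => hg k (by omega) (by omega)

lemma Glued.trans {i h x : Fin r} {j : ℕ} (h₁ : Glued q i h j) (h₂ : Glued q h x j) :
    Glued q i x j := fun k h1 h2 => by
  by_cases hk : min (i : ℕ) h ≤ k ∧ (k : ℕ) < max (i : ℕ) h
  · exact h₁ k hk.1 hk.2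
  · exact h₂ k (by omega) (by omega)

lemma glued_succ_iff {k : ℕ} (hk : k + 1 < r) (j : ℕ) :
    Glued q ⟨k, by omega⟩ ⟨k + 1, hk⟩ j ↔ j < q ⟨k, by omega⟩ := by
  constructor
  · intro h
    exact h ⟨k, by omega⟩ (by simp) (by simp)
  · intro h x h1 h2
    simp only at h1 h2
    have hx : x = ⟨k, by omega⟩ := Fin.ext (by simp only; omega)
    rw [hx]
    exact h

lemma glued_iff_of_lt {i h : Fin r} (hih : i < h) (j : ℕ) :
    Glued q i h j ↔ ∀ (k : ℕ) (hk : k + 1 < r), (i : ℕ) ≤ k → k < (h : ℕ) →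
      j < q ⟨k, by omega⟩ := by
  have hih' : (i : ℕ) < h := hih
  constructor
  · intro hg k hk h1 h2
    exact hg ⟨k, by omega⟩ (by simp only; omega) (by simp only; omega)
  · intro H k h1 h2
    exact H k (by omega) (by omega) (by omega)

lemma treeOf_apply_of_glued {i h : Fin r} {j : ℕ} (hg : Glued q i h j) :
    treeOf E q i j h = E h j := if_pos hg

lemma treeOf_apply_of_not_glued {i h : Fin r} {j : ℕ} (hg : ¬ Glued q i h j) :
    treeOf E q i j h = 0 := if_neg hg

lemma branchSeq_treeOf (i : Fin r) : branchSeq (treeOf E q) i = E i :=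
  funext fun j => treeOf_apply_of_glued (Glued.refl i j)

lemma treeOf_eq_iff (hE : ∀ i j, 0 < E i j) {i h : Fin r} {j : ℕ} :
    treeOf E q i j = treeOf E q h j ↔ Glued q i h j := by
  constructor
  · intro heq
    by_contra hg
    have h1 := congrFun heq h
    rw [treeOf_apply_of_not_glued hg, treeOf_apply_of_glued (Glued.refl h j)] at h1
    exact (hE h j).ne h1
  · intro hg
    ext x
    by_cases hx : Glued q h x j
    · rw [treeOf_apply_of_glued hx, treeOf_apply_of_glued (hg.trans hx)]
    · rw [treeOf_apply_of_not_glued hx,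
        treeOf_apply_of_not_glued fun hx' => hx (hg.symm.trans hx')]

lemma isUntwisted_treeOf (hE : ∀ i j, 0 < E i j) : IsUntwisted (treeOf E q) := by
  intro i h hih j
  simp only [treeOf_eq_iff hE, glued_succ_iff, glued_iff_of_lt hih]

lemma isVecTree_treeOf (hE : ∀ i j, 0 < E i j) (hq : ∀ k, 1 ≤ q k) :
    IsVecTree (treeOf E q) where
  root i h := (treeOf_eq_iff hE).2 fun k _ _ => hq k
  parent i h j hj := (treeOf_eq_iff hE).2 fun k h1 h2 => by
    have := (treeOf_eq_iff hE).1 hj k h1 h2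
    omega
  support i j h := by
    rw [Ne, treeOf_eq_iff hE]
    constructor
    · intro h0 hg
      rw [treeOf_apply_of_glued hg] at h0
      exact (hE h j).ne' h0
    · exact treeOf_apply_of_not_glued

/-- Branches glued at a level have all intermediate branches glued there, so agreement passes along
consecutive pairs. -/
lemma admissible_treeOf_iff (hE : ∀ i j, 0 < E i j) {K : Fin r → ℕ} :
    Admissible (treeOf E q) K ↔ ∀ (k : ℕ) (hk : k + 1 < r),
      LevelsAgree (· < q ⟨k, by omega⟩) (K ⟨k, by omega⟩) (K ⟨k + 1, hk⟩) := by
  constructor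
  · intro H k hk j hj
    exact H _ _ j ((treeOf_eq_iff hE).2 ((glued_succ_iff hk j).2 hj))
  · intro H
    have key : ∀ (i h : ℕ) (hih : i ≤ h) (hh : h < r) (j : ℕ),
        Glued q ⟨i, by omega⟩ ⟨h, hh⟩ j → (j < K ⟨i, by omega⟩ ↔ j < K ⟨h, hh⟩) := by
      intro i h hih
      induction h, hih using Nat.le_induction with
      | base => exact fun _ _ _ => Iff.rfl
      | succ h hih ih =>
        intro hh j hg
        rw [ih (by omega) j fun k h1 h2 => hg k (by simp only at *; omega)
          (by simp only at *; omega)]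
        exact H h hh j (hg ⟨h, by omega⟩ (by simp only; omega) (by simp only; omega))
    intro i h j hj
    have hg := (treeOf_eq_iff hE).1 hj
    rcases le_total i h with hih | hih
    · exact key i h hih h.2 j hg
    · exact (key h i hih i.2 j hg.symm).symm

/-- In a finite sequence in which equal terms are connected by equal consecutive terms, the
number of values and the number of repetitions add up to the length. -/
lemma card_image_add_card_repetitions {α : Type*} [DecidableEq α] (f : ℕ → α) (m : ℕ)
    (hf : ∀ a b, a ≤ b → b + 1 < m → f a = f (b + 1) → f b = f (b + 1)) :
    ((Finset.range m).image f).card +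
      ((Finset.range (m - 1)).filter fun k => f k = f (k + 1)).card = m := by
  induction m with
  | zero => simp
  | succ m ih =>
    have ih := ih fun a b h1 h2 => hf a b h1 (by omega)
    cases m with
    | zero => simp
    | succ m =>
      simp only [Nat.add_sub_cancel] at ih ⊢
      rw [Finset.range_add_one (n := m + 1), Finset.image_insert, Finset.range_add_one (n := m),
        Finset.filter_insert, ← Finset.range_add_one]
      by_cases hm : f m = f (m + 1)
      · have hmem : f (m + 1) ∈ (Finset.range (m + 1)).image f := by
          rw [← hm]
          exact Finset.mem_image_of_mem _ (by simp)
        rw [if_pos hm, Finset.insert_eq_of_mem hmem, Finset.card_insert_of_notMem (by simp)]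
        omega
      · rw [if_neg hm, Finset.card_insert_of_notMem]
        · omega
        · intro hmem
          obtain ⟨a, ha, hfa⟩ := Finset.mem_image.1 hmem
          simp only [Finset.mem_range] at ha
          exact hm (hf a m (by omega) (by omega) hfa)

lemma card_level_treeOf (hE : ∀ i j, 0 < E i j) (j : ℕ) :
    (Finset.univ.image fun i => treeOf E q i j).card +
      (Finset.univ.filter fun k => j < q k).card = r := by
  classical
  let f : ℕ → Fin r → ℕ := fun i => if h : i < r then treeOf E q ⟨i, h⟩ j else 0
  have hf : ∀ i (h : i < r), f i = treeOf E q ⟨i, h⟩ j := fun i h => dif_pos h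
  have key := card_image_add_card_repetitions f r (by
    intro a b hab hb heq
    rw [hf _ (by omega), hf _ hb, treeOf_eq_iff hE] at heq ⊢
    exact fun k h1 h2 => heq k (by simp only at *; omega) (by simp only at *; omega))
  convert key using 2
  · congr 1
    ext v
    simp only [Finset.mem_image, Finset.mem_univ, true_and, Finset.mem_range]
    constructor
    · rintro ⟨i, rfl⟩; exact ⟨i, i.2, hf i i.2⟩
    · rintro ⟨i, hi, rfl⟩; exact ⟨⟨i, hi⟩, (hf i hi).symm⟩
  · refine Finset.card_bij (fun k _ => (k : ℕ)) ?_ ?_ ?_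
    · intro k hk
      have hkr := k.2
      simp only [Finset.mem_filter, Finset.mem_univ, true_and, Finset.mem_range] at hk ⊢
      refine ⟨hkr, ?_⟩
      rw [hf _ (by omega), hf _ (by omega), treeOf_eq_iff hE, glued_succ_iff]
      exact hk
    · intro a _ b _ hab; exact Fin.ext hab
    · intro k hk
      simp only [Finset.mem_filter, Finset.mem_range] at hk
      obtain ⟨hkr, hk⟩ := hk
      rw [hf _ (by omega), hf _ (by omega), treeOf_eq_iff hE, glued_succ_iff] at hk
      exact ⟨⟨k, hkr⟩, by simpa using hk, rfl⟩

lemma card_nodes_const (T : VecTree r) (N : ℕ) :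
    (nodes T fun _ => N).card =
      ∑ j ∈ Finset.range N, (Finset.univ.image fun i => T i j).card := by
  classical
  have h : nodes T (fun _ => N) =
      ((Finset.range N).sigma fun j => Finset.univ.image fun i => T i j).image
        fun x => (x.1, x.2) := by
    ext ⟨j, v⟩
    simp only [mem_nodes, Finset.mem_image, Finset.mem_sigma, Finset.mem_range, Finset.mem_univ,
      true_and, Prod.mk.injEq]
    constructor
    · rintro ⟨i, hi, rfl⟩; exact ⟨⟨j, _⟩, ⟨hi, i, rfl⟩, rfl, rfl⟩
    · rintro ⟨⟨j, v⟩, ⟨hj, i, hi⟩, rfl, rfl⟩; exact ⟨i, hj, hi.symm⟩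
  rw [h, Finset.card_image_of_injective, Finset.card_sigma]
  rintro ⟨a, b⟩ ⟨c, d⟩ hac
  simpa using hac

/-- Sum of `card_level_treeOf` over the levels, with the pairs (k, j), j < q k, counted in two ways;
`hN` ensures that no glued level is missed. -/
lemma card_nodes_treeOf (hE : ∀ i j, 0 < E i j) {N : ℕ} (hN : ∀ k, q k ≤ N) :
    (nodes (treeOf E q) fun _ => N).card + ∑ k, q k = r * N := by
  classical
  have hq : ∑ k, q k = ∑ j ∈ Finset.range N, (Finset.univ.filter fun k => j < q k).card := by
    simp only [Finset.card_filter]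
    rw [Finset.sum_comm]
    refine Finset.sum_congr rfl fun k _ => ?_
    rw [← Finset.card_filter]
    have : (Finset.range N).filter (fun j => j < q k) = Finset.range (q k) := by
      ext j
      have := hN k
      simp only [Finset.mem_filter, Finset.mem_range]
      omega
    rw [this, Finset.card_range]
  rw [card_nodes_const, hq, ← Finset.sum_add_distrib,
    Finset.sum_congr rfl fun j _ => card_level_treeOf hE j]
  simp [mul_comm]

/-- The numerical conditions on the sequences and gluing levels of an untwisted multiplicity
tree. -/
structure IsGluingData (E : Fin r → ℕ → ℕ) (q : Fin (r - 1) → ℕ) : Prop where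
  isMultSeq : ∀ i, IsMultSeq (E i)
  one_le : ∀ k, 1 ≤ q k
  le_comp : ∀ (k : ℕ) (hk : k + 1 < r),
    (q ⟨k, by omega⟩ : ℕ∞) ≤ Comp (E ⟨k, by omega⟩) (E ⟨k + 1, hk⟩)

lemma IsArfTree.le_of_treeOf {N : ℕ} (hT : IsArfTree (treeOf E q) N) (hE : ∀ i j, 0 < E i j)
    (k : Fin (r - 1)) : q k ≤ N := by
  by_contra hlt
  have hk : (k : ℕ) + 1 < r := by omega
  have := hT.tail_unglued ⟨k, by omega⟩ ⟨k + 1, hk⟩ N le_rfl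
    ((treeOf_eq_iff hE).2 ((glued_succ_iff hk N).2 (not_le.1 hlt)))
  simp at this

lemma IsArfTree.genus_eq_iff {N : ℕ} (hT : IsArfTree (treeOf E q) N) (hE : ∀ i j, 0 < E i j)
    (n : ℕ) :
    n + (nodes (treeOf E q) fun _ => N).card =
        ∑ i, partialSum (branchSeq (treeOf E q) i) N ↔
      n = ∑ i, seqGenus (E i) + ∑ k, q k := by
  have h1 := card_nodes_treeOf hE (hT.le_of_treeOf hE)
  have h2 : ∑ i, partialSum (branchSeq (treeOf E q) i) N = r * N + ∑ i, seqGenus (E i) := by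
    rw [Finset.sum_congr rfl fun i _ => partialSum_eq_add_seqGenus
      (hT.vecTree.branchSeq_pos i) (hT.tail_one i), Finset.sum_add_distrib]
    simp [branchSeq_treeOf]
  omega

lemma IsArfTree.isGluingData {N : ℕ} (hT : IsArfTree (treeOf E q) N) : IsGluingData E q := by
  have hE : ∀ i j, 0 < E i j := fun i => branchSeq_treeOf (E := E) (q := q) i ▸
    hT.vecTree.branchSeq_pos i
  refine ⟨fun i => branchSeq_treeOf (E := E) (q := q) i ▸ hT.isMultSeq i, fun k => ?_,
    fun k hk => (le_comp_iff _ _ _).2 fun j => ?_⟩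
  · have hk : (k : ℕ) + 1 < r := by omega
    exact (glued_succ_iff hk 0).1 ((treeOf_eq_iff hE).1
      (hT.vecTree.root ⟨k, by omega⟩ ⟨k + 1, hk⟩))
  · have := (admissible_treeOf_iff hE).1 (hT.admissible_sumEnd j) k hk
    simpa only [branchSeq_treeOf] using this

lemma IsGluingData.exists_isArfTree (h : IsGluingData E q) :
    ∃ N, IsArfTree (treeOf E q) N := by
  have hE : ∀ i j, 0 < E i j := fun i => (h.isMultSeq i).pos
  choose N hN using fun i => (h.isMultSeq i).tail
  have hle : ∀ i, N i ≤ ∑ i, N i := fun i =>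
    Finset.single_le_sum (f := N) (fun _ _ => Nat.zero_le _) (Finset.mem_univ i)
  have hleq : ∀ k, q k ≤ ∑ k, q k := fun k =>
    Finset.single_le_sum (f := q) (fun _ _ => Nat.zero_le _) (Finset.mem_univ k)
  refine ⟨∑ i, N i + ∑ k, q k, isVecTree_treeOf hE h.one_le, ?_, ?_, fun j => ?_⟩
  · intro i j hj
    rw [branchSeq_treeOf]
    exact hN i j (by have := hle i; omega)
  · intro i x j hj heq
    rw [treeOf_eq_iff hE] at heq
    by_contra hne
    have hne' : (i : ℕ) ≠ x := fun h => hne (Fin.ext h)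
    have h1 := i.2
    have h2 := x.2
    -- A single index between the two branches suffices: its gluing level would exceed the sum of
    -- all of them.
    have h3 := heq ⟨min (i : ℕ) x, by omega⟩ le_rfl (by simp only; omega)
    have := hleq ⟨min (i : ℕ) x, by omega⟩
    omega
  · refine ⟨fun i => sumEnd (E i) j, (admissible_treeOf_iff hE).2 fun k hk =>
      (le_comp_iff _ _ _).1 (h.le_comp k hk) j, fun i => ?_⟩
    rw [branchSeq_treeOf]
    exact (h.isMultSeq i).sum_eq j

lemma treeOf_mem_gen_iff {n : ℕ} :
    treeOf E q ∈ Gen r n ↔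
      IsGluingData E q ∧ n = ∑ i, seqGenus (E i) + ∑ k, q k := by
  rw [mem_gen_iff]
  constructor
  · rintro ⟨-, N, hN, hn⟩
    have h := hN.isGluingData
    exact ⟨h, (hN.genus_eq_iff (fun i => (h.isMultSeq i).pos) n).1 hn⟩
  · rintro ⟨h, hn⟩
    have hE : ∀ i j, 0 < E i j := fun i => (h.isMultSeq i).pos
    obtain ⟨N, hN⟩ := h.exists_isArfTree
    exact ⟨isUntwisted_treeOf hE, N, hN, (hN.genus_eq_iff hE n).2 hn⟩

end

lemma exists_eq_treeOf {r n : ℕ} {T : VecTree r} (hT : T ∈ Gen r n) :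
    ∃ E q, T = treeOf E q := by
  classical
  obtain ⟨hu, N, hN, -⟩ := mem_gen_iff.1 hT
  have hex : ∀ k : Fin (r - 1), ∃ j,
      T ⟨k, by omega⟩ j ≠ T ⟨(k : ℕ) + 1, by omega⟩ j := fun k =>
    ⟨N, fun h => by simpa using hN.tail_unglued _ _ N le_rfl h⟩
  have hfind : ∀ k j, j < Nat.find (hex k) ↔
      T ⟨k, by omega⟩ j = T ⟨(k : ℕ) + 1, by omega⟩ j := by
    intro k j
    constructor
    · intro h; exact not_not.1 (Nat.find_min (hex k) h)
    · intro h
      by_contra hlt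
      exact Nat.find_spec (hex k) (hN.vecTree.glued_of_le (not_lt.1 hlt) h)
  have hlt : ∀ i h j, i < h → (T i j = T h j ↔ Glued (fun k => Nat.find (hex k)) i h j) := by
    intro i h j hih
    rw [hu i h hih j, glued_iff_of_lt hih]
    exact forall₄_congr fun k hk _ _ => (hfind ⟨k, by omega⟩ j).symm
  have hglue : ∀ i h j, T i j = T h j ↔ Glued (fun k => Nat.find (hex k)) i h j := by
    intro i h j
    rcases lt_trichotomy i h with hih | rfl | hih
    · exact hlt i h j hih
    · exact iff_of_true rfl (Glued.refl i j)
    · rw [eq_comm, hlt h i j hih]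
      exact ⟨Glued.symm, Glued.symm⟩
  -- The first unglued index, counted from 0, is the highest glued level, counted from 1.
  refine ⟨branchSeq T, fun k => Nat.find (hex k), ?_⟩
  ext i j h
  by_cases hg : T i j = T h j
  · rw [treeOf_apply_of_glued ((hglue i h j).1 hg), hg]
    rfl
  · rw [treeOf_apply_of_not_glued fun h' => hg ((hglue i h j).2 h')]
    exact (hN.vecTree.support i j h).2 hg

/-! ### Cutting an untwisted tree between two consecutive branches -/

lemma sum_fin_split {m a b : ℕ} (h : m = a + b) (f : Fin m → ℕ) :
    ∑ i, f i = ∑ i : Fin a, f ⟨i, by omega⟩ + ∑ i : Fin b, f ⟨a + i, by omega⟩ := by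
  subst h
  exact Fin.sum_univ_add f

lemma sum_fin_split_at {r t : ℕ} (ht : 1 ≤ t) (htr : t < r) (q : Fin (r - 1) → ℕ) :
    ∑ k, q k = ∑ k : Fin (t - 1), q ⟨k, by omega⟩ + q ⟨t - 1, by omega⟩ +
      ∑ k : Fin (r - t - 1), q ⟨t + k, by omega⟩ := by
  rw [sum_fin_split (show r - 1 = t + (r - t - 1) by omega),
    sum_fin_split (show t = (t - 1) + 1 by omega)]
  simp

lemma isGluingData_split_iff {r t : ℕ} (ht : 1 ≤ t) (htr : t < r) {E : Fin r → ℕ → ℕ}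
    {q : Fin (r - 1) → ℕ} :
    IsGluingData E q ↔
      IsGluingData (fun i : Fin t => E ⟨i, by omega⟩)
        (fun l : Fin (t - 1) => q ⟨l, by omega⟩) ∧
      IsGluingData (fun i : Fin (r - t) => E ⟨t + i, by omega⟩)
        (fun l : Fin (r - t - 1) => q ⟨t + l, by omega⟩) ∧
      1 ≤ q ⟨t - 1, by omega⟩ ∧
      (q ⟨t - 1, by omega⟩ : ℕ∞) ≤ Comp (E ⟨t - 1, by omega⟩) (E ⟨t, htr⟩) := by
  -- Writing t = u + 1 lets the index t - 1 reduce definitionally.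
  obtain ⟨u, rfl⟩ : ∃ u, t = u + 1 := ⟨t - 1, by omega⟩
  constructor
  · intro h
    exact ⟨⟨fun i => h.isMultSeq _, fun k => h.one_le _, fun k hk => h.le_comp k (by omega)⟩,
      ⟨fun i => h.isMultSeq _, fun k => h.one_le _, fun k hk => h.le_comp (u + 1 + k) (by omega)⟩,
      h.one_le _, h.le_comp u htr⟩
  · rintro ⟨h₁, h₂, hq, hc⟩
    refine ⟨fun i => ?_, fun k => ?_, fun k hk => ?_⟩
    · by_cases hi : (i : ℕ) < u + 1
      · exact h₁.isMultSeq ⟨i, hi⟩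
      · have := h₂.isMultSeq ⟨i - (u + 1), by omega⟩
        simpa only [Nat.add_sub_cancel' (not_lt.1 hi)] using this
    · rcases lt_trichotomy (k : ℕ) u with hk | hk | hk
      · exact h₁.one_le ⟨k, hk⟩
      · have : k = ⟨u + 1 - 1, by omega⟩ := Fin.ext hk
        rw [this]
        exact hq
      · have := h₂.one_le ⟨k - (u + 1), by omega⟩
        simpa only [Nat.add_sub_cancel' (show u + 1 ≤ (k : ℕ) from hk)] using this
    · rcases lt_trichotomy k u with h | rfl | h
      · exact h₁.le_comp k (by omega)
      · exact hc
      · obtain ⟨x, rfl⟩ := Nat.exists_eq_add_of_le (show u + 1 ≤ k from h)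
        exact h₂.le_comp x (by omega)

lemma IsGluingData.le_sum {r : ℕ} {E : Fin r → ℕ → ℕ} {q : Fin (r - 1) → ℕ}
    (h : IsGluingData E q) : r - 1 ≤ ∑ k, q k := by
  simpa using Finset.sum_le_sum fun k (_ : k ∈ Finset.univ) => h.one_le k

end ArfGenus

/-- Under the hypotheses no natural-number subtraction below is truncated: `n + 2 - r`
is `n - r + 2`, and `n + t + 1 - p - r` is `n - p - r + t + 1`. -/
theorem mainTheorem2 (r n t : ℕ) (hr : 2 ≤ r) (ht : 1 ≤ t) (htr : t < r) :
    (r - 1 ≤ n →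
      ArfGenus.Gen r n =
        ⋃ p ∈ Finset.Icc 1 (n + 2 - r), ⋃ k ∈ Finset.Icc (t - 1) (n + t + 1 - p - r),
          ArfGenus.glueSet r n t ht htr p k) ∧
    (n < r - 1 → ArfGenus.Gen r n = ∅) := by
  refine ⟨fun hn => ?_, fun hn => ?_⟩
  · ext T
    simp only [Set.mem_iUnion, Finset.mem_Icc, exists_prop]
    constructor
    · intro hT
      obtain ⟨E, q, rfl⟩ := ArfGenus.exists_eq_treeOf hT
      obtain ⟨hd, hg⟩ := ArfGenus.treeOf_mem_gen_iff.1 hT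
      obtain ⟨h₁, h₂, hq, hc⟩ := (ArfGenus.isGluingData_split_iff ht htr).1 hd
      rw [ArfGenus.sum_fin_split (show r = t + (r - t) by omega),
        ArfGenus.sum_fin_split_at ht htr] at hg
      have l₁ := h₁.le_sum
      have l₂ := h₂.le_sum
      -- The value of `k` is left open and becomes the genus of the left half through `rfl`; its
      -- bounds follow from `l₁` and `l₂`.
      refine ⟨q ⟨t - 1, by omega⟩, ⟨hq, by omega⟩, _, ⟨?_, ?_⟩, E, q, rfl,
        ArfGenus.treeOf_mem_gen_iff.2 ⟨h₁, rfl⟩, ArfGenus.treeOf_mem_gen_iff.2 ⟨h₂, ?_⟩, rfl, hc⟩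
      · omega
      · omega
      · omega
    · rintro ⟨p, ⟨hp₁, hp₂⟩, k, ⟨hk₁, hk₂⟩, E, q, rfl, h₁, h₂, rfl, hc⟩
      rw [ArfGenus.treeOf_mem_gen_iff] at h₁ h₂ ⊢
      refine ⟨(ArfGenus.isGluingData_split_iff ht htr).2 ⟨h₁.1, h₂.1, hp₁, hc⟩, ?_⟩
      have g₁ := h₁.2
      have g₂ := h₂.2
      rw [ArfGenus.sum_fin_split (show r = t + (r - t) by omega),
        ArfGenus.sum_fin_split_at ht htr]
      -- The bound `hk₂` gives p + k ≤ n, so n - p - k is not truncated.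
      omega
  · refine Set.eq_empty_iff_forall_notMem.2 fun T hT => ?_
    obtain ⟨E, q, rfl⟩ := ArfGenus.exists_eq_treeOf hT
    obtain ⟨hd, hg⟩ := ArfGenus.treeOf_mem_gen_iff.1 hT
    have := hd.le_sum
    omega
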